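/- Conventions. Let $n\ge 1$ and let $d$ be the Euclidean metric of $\mathbb{R}^n$. Write $\beta(s,t,u)$ iff $d(s,u)=d(s,t)+d(t,u)$, and call $s,t,u$ collinear if $\beta(s,t,u)$, $\beta(s,u,t)$ or $\beta(t,s,u)$ holds. For $T\subseteq\mathbb{R}^n$, $(T,\beta)$ denotes the structure with domain $T$ and the restriction of $\beta$ to $T$. A set $L\subseteq T$ is a *line in $T$* if it contains two distinct points, any three of its points are collinear, and whenever $s\neq t$ are in $L$ and $u\in T$ satisfies $\beta(s,u,t)$ or $\beta(s,t,u)$, then $u\in L$. An *$m$-dimensional flat* is a translate of the linear span of $m$ linearly independent vectors of $\mathbb{R}^n$. A set $U\subseteq\mathbb{R}^n$ is a *linearly regular $m$-dimensional flat* ($0\le m\le n$) if 1. $U$ is contained in some $m$-dimensional flat; 2. $U$ is not contained in any $(m-1)$-dimensional flat; 3. if $L$ is a line in $U$ and $L'\supseteq L$ is the corresponding line in $\mathbb{R}^n$, then for every $r\in L'$ and $\epsilon>0$ there is $s\in L$ with $d(s,r)<\epsilon$; 4. if $L_1\neq L_2$ are lines in $U$, contained in lines $L_1',L_2'$ of $\mathbb{R}^n$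 with $L_1'\cap L_2'\neq\emptyset$, then $L_1\cap L_2\neq\emptyset$. A set $T\subseteq\mathbb{R}^n$ *extends linearly in $mD$* ($m\le n$) if there are a linearly regular $m$-dimensional flat $S$, a real $\epsilon>0$ and a point $x\in S\cap T$ such that $\{u\in S : d(x,u)<\epsilon\}\subseteq T$. A *monadic $\Pi^1_1$-sentence* of the vocabulary $\{\beta\}$ is a sentence $\forall X_0\cdots\forall X_{k-1}\,\varphi$, where $\varphi$ is a first-order sentence (with equality) of the vocabulary $\{\beta,X_0,\dots,X_{k-1}\}$ and the $X_i$ are unary relation variables ranging over all subsets of the domain. The *monadic $\Pi^1_1$-theory* of $(T,\beta)$ is the set of all monadic $\Pi^1_1$-sentences of the vocabulary $\{\beta\}$ that are true in $(T,\beta)$. Sentences are identified with natural numbers by a standard Gödel numbering. A set $A$ of sentences is *$\Sigma^0_1$-hard* if for every recursively enumerable $B\subseteq\mathbb{N}$ there is a computable map $f$ from $\mathbb{N}$ to sentences with $m\in B\Leftrightarrow f(m)\in A$ for all $m\in\mathbb{N}$, and *undecidable* if no algorithm decides, for each given sentence, whether it belongs to $A$. **Theorem.** Let $T\subseteq\mathbb{R}^n$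 extend linearly in $2D$. Then: (a) The monadic $\Pi^1_1$-theory of $(T,\beta)$ is $\Sigma^0_1$-hard. (b) Let $\mathcal{C}$ be the class of all expansions $(T,\beta,(P_i)_{i\in\mathbb{N}})$ of $(T,\beta)$ with arbitrary unary predicates $P_i\subseteq T$. The first-order theory of $\mathcal{C}$, i.e. the set of first-order sentences of the vocabulary $\{\beta\}\cup\{P_i : i\in\mathbb{N}\}$ that are true in every structure of $\mathcal{C}$, is undecidable. -/

import Mathlib

namespace AffineBetweenness

open scoped FirstOrder

/-! ### Subsets of Euclidean space -/

section Geometry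

variable {n : ℕ}

/-- `t` lies (weakly) between `s` and `u`. -/
def Betw (s t u : EuclideanSpace ℝ (Fin n)) : Prop :=
  dist s u = dist s t + dist t u

/-- The three points lie on a common line, expressed through betweenness. -/
def CollinearPts (s t u : EuclideanSpace ℝ (Fin n)) : Prop :=
  Betw s t u ∨ Betw s u t ∨ Betw t s u

/-- `L` is a line in `T`. The lines of the whole space are the lines in `Set.univ`. -/
def IsLineIn (T L : Set (EuclideanSpace ℝ (Fin n))) : Prop :=
  L ⊆ T ∧
  (∃ s ∈ L, ∃ t ∈ L, s ≠ t) ∧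
  (∀ s ∈ L, ∀ t ∈ L, ∀ u ∈ L, CollinearPts s t u) ∧
  (∀ s ∈ L, ∀ t ∈ L, s ≠ t → ∀ u ∈ T, Betw s u t ∨ Betw s t u → u ∈ L)

/-- `S` is an `m`-dimensional flat: a translate of the span of `m` linearly independent vectors. -/
def IsFlat (m : ℕ) (S : Set (EuclideanSpace ℝ (Fin n))) : Prop :=
  ∃ (v : Fin m → EuclideanSpace ℝ (Fin n)) (h : EuclideanSpace ℝ (Fin n)),
    LinearIndependent ℝ v ∧ S = {u | ∃ r : Fin m → ℝ, u = h + ∑ i, r i • v i}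

/-- Every line in `U` is dense in the line of the whole space that contains it. -/
def LinearlyComplete (U : Set (EuclideanSpace ℝ (Fin n))) : Prop :=
  ∀ L L' : Set (EuclideanSpace ℝ (Fin n)), IsLineIn U L → IsLineIn Set.univ L' → L ⊆ L' →
    ∀ r ∈ L', ∀ ε : ℝ, 0 < ε → ∃ s ∈ L, dist s r < ε

/-- Distinct lines in `U` whose extensions to the whole space meet have a common point in `U`. -/
def LinearlyClosed (U : Set (EuclideanSpace ℝ (Fin n))) : Prop :=
  ∀ L₁ L₂ L₁' L₂' : Set (EuclideanSpace ℝ (Fin n)),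
    IsLineIn U L₁ → IsLineIn U L₂ → L₁ ≠ L₂ →
    IsLineIn Set.univ L₁' → IsLineIn Set.univ L₂' → L₁ ⊆ L₁' → L₂ ⊆ L₂' →
    (L₁' ∩ L₂').Nonempty → (L₁ ∩ L₂).Nonempty

/-- `U` is a linearly regular `m`-dimensional flat. -/
structure IsLinearlyRegularFlat (m : ℕ) (U : Set (EuclideanSpace ℝ (Fin n))) : Prop where
  dim_le : m ≤ n
  subset_flat : ∃ S, IsFlat m S ∧ U ⊆ S
  not_subset_smaller : ∀ k, k + 1 = m → ¬ ∃ S, IsFlat k S ∧ U ⊆ S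
  complete : LinearlyComplete U
  closed : LinearlyClosed U

/-- `T` extends linearly in dimension `m`. -/
def ExtendsLinearly (m : ℕ) (T : Set (EuclideanSpace ℝ (Fin n))) : Prop :=
  ∃ S : Set (EuclideanSpace ℝ (Fin n)), IsLinearlyRegularFlat m S ∧
    ∃ ε : ℝ, 0 < ε ∧ ∃ x ∈ S ∩ T, {u | u ∈ S ∧ dist x u < ε} ⊆ T

end Geometry

/-! ### The vocabulary `{β} ∪ {P i | i : ι}` and its structures `(T, β, (P i))` -/

/-- A ternary symbol for betweenness and one unary symbol for each `i : ι`. -/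
inductive BetaRel (ι : Type) : ℕ → Type
  | beta : BetaRel ι 3
  | pred (i : ι) : BetaRel ι 1

/-- The relational first-order language `{β} ∪ {P i | i : ι}`. -/
def betaLang (ι : Type) : FirstOrder.Language.{0, 0} where
  Functions := fun _ => Empty
  Relations := BetaRel ι

/-- The expansion of `(T, β)` by the unary predicates `P i`. -/
@[reducible]
def expansion {n : ℕ} (T : Set (EuclideanSpace ℝ (Fin n))) {ι : Type} (P : ι → Set T) :
    (betaLang ι).Structure T where
  funMap := fun f _ => Empty.elim f
  RelMap := fun {_} R =>
    match R with
    | BetaRel.beta => fun v => Betw (v 0 : EuclideanSpace ℝ (Fin n)) (v 1) (v 2)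
    | BetaRel.pred i => fun v => v 0 ∈ P i

/-- The sentence `φ` is true in `(T, β, (P i))`. -/
def HoldsIn {n : ℕ} (T : Set (EuclideanSpace ℝ (Fin n))) {ι : Type} (P : ι → Set T)
    (φ : (betaLang ι).Sentence) : Prop :=
  letI := expansion T P
  T ⊨ φ

/-! ### Gödel numbers -/

/-- Every term of the language is a variable; its number is the de Bruijn level. -/
def termCode {ι : Type} {k : ℕ} : (betaLang ι).Term (Empty ⊕ Fin k) → ℕ
  | .var (Sum.inl e) => e.elim
  | .var (Sum.inr i) => i
  | .func f _ => Empty.elim f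

/-- The number of an atomic formula `β x y z` or `P i x`, from the numbers of its terms. -/
def relCode {ι : Type} [Encodable ι] : {l : ℕ} → BetaRel ι l → (Fin l → ℕ) → ℕ
  | _, .beta, t => 5 * Nat.pair (t 0) (Nat.pair (t 1) (t 2)) + 2
  | _, .pred i, t => 5 * Nat.pair (Encodable.encode i) (t 0) + 3

/-- The Gödel number of a formula with bound variables `0, …, k - 1` and no free variables
of other kinds. -/
def formulaCode {ι : Type} [Encodable ι] : {k : ℕ} → (betaLang ι).BoundedFormula Empty k → ℕ
  | _, .falsum => 0
  | _, .equal t₁ t₂ => 5 * Nat.pair (termCode t₁) (termCode t₂) + 1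
  | _, .rel R ts => relCode R fun i => termCode (ts i)
  | _, .imp φ ψ => 5 * Nat.pair (formulaCode φ) (formulaCode ψ) + 4
  | _, .all φ => 5 * formulaCode φ + 5

/-- The Gödel number of a first-order sentence. -/
def sentenceCode {ι : Type} [Encodable ι] (φ : (betaLang ι).Sentence) : ℕ :=
  formulaCode φ

theorem termCode_injective {ι : Type} {k : ℕ} :
    Function.Injective (termCode : (betaLang ι).Term (Empty ⊕ Fin k) → ℕ) := by
  rintro ((e | i) | ⟨f, -⟩) ((e' | j) | ⟨f', -⟩) h
  all_goals first | exact e.elim | exact e'.elim | exact Empty.elim f | exact Empty.elim f' | skip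
  exact congrArg (fun i => FirstOrder.Language.Term.var (Sum.inr i)) (Fin.ext h)

theorem formulaCode_injective {ι : Type} [Encodable ι] {k : ℕ} :
    Function.Injective (formulaCode : (betaLang ι).BoundedFormula Empty k → ℕ) := by
  have key : ∀ a b c : ℕ, 5 * a + c = 5 * b + c → a = b := by omega
  intro φ
  induction φ with
  | falsum =>
    intro ψ h
    cases ψ with
    | falsum => rfl
    | equal | imp | all => simp [formulaCode] at h
    | rel R ts => cases R <;> simp [formulaCode, relCode] at h
  | equal t₁ t₂ =>
    intro ψ h
    cases ψ with
    | equal =>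
      have h' := Nat.pair_eq_pair.1 (key _ _ _ h)
      rw [termCode_injective h'.1, termCode_injective h'.2]
    | falsum | imp | all => simp only [formulaCode] at h; omega
    | rel R ts => cases R <;> simp only [formulaCode, relCode] at h <;> omega
  | rel R ts =>
    intro ψ h
    cases ψ with
    | falsum | equal | imp | all =>
      cases R <;> simp only [formulaCode, relCode] at h <;> omega
    | rel R' ts' =>
      cases R <;> cases R' <;> simp only [formulaCode, relCode] at h
      · have h' := Nat.pair_eq_pair.1 (key _ _ _ h)
        have h'' := Nat.pair_eq_pair.1 h'.2
        congr 1
        funext i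
        fin_cases i
        exacts [termCode_injective h'.1, termCode_injective h''.1, termCode_injective h''.2]
      · omega
      · omega
      · have h' := Nat.pair_eq_pair.1 (key _ _ _ h)
        rw [Encodable.encode_injective h'.1]
        congr 1
        funext i
        fin_cases i
        exact termCode_injective h'.2
  | imp φ ψ ih₁ ih₂ =>
    intro χ h
    cases χ with
    | imp =>
      have h' := Nat.pair_eq_pair.1 (key _ _ _ h)
      rw [ih₁ h'.1, ih₂ h'.2]
    | falsum | equal | all => simp only [formulaCode] at h; omega
    | rel R ts => cases R <;> simp only [formulaCode, relCode] at h <;> omega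
  | all φ ih =>
    intro χ h
    cases χ with
    | all => rw [ih (key _ _ _ h)]
    | falsum | equal | imp => simp only [formulaCode] at h; omega
    | rel R ts => cases R <;> simp only [formulaCode, relCode] at h <;> omega

/-! ### Monadic `Π¹₁` sentences over `{β}` and the theories -/

/-- A monadic `Π¹₁` sentence `∀ X₀ … ∀ X_{k-1} φ` of the vocabulary `{β}`, where `φ` is a
first-order sentence of the vocabulary `{β, X₀, …, X_{k-1}}`. -/
structure MonadicPi11Sentence where
  numSetVars : ℕ
  matrix : (betaLang (Fin numSetVars)).Sentence

/-- The Gödel number of a monadic `Π¹₁` sentence. -/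
def MonadicPi11Sentence.code (Φ : MonadicPi11Sentence) : ℕ :=
  Nat.pair Φ.numSetVars (sentenceCode Φ.matrix)

theorem MonadicPi11Sentence.code_injective : Function.Injective MonadicPi11Sentence.code := by
  rintro ⟨k, φ⟩ ⟨l, ψ⟩ h
  obtain ⟨rfl, h⟩ := Nat.pair_eq_pair.1 h
  exact congrArg (MonadicPi11Sentence.mk k) (formulaCode_injective h)

/-- The monadic `Π¹₁`-theory of `(T, β)`. -/
def monadicPi11Theory {n : ℕ} (T : Set (EuclideanSpace ℝ (Fin n))) : Set MonadicPi11Sentence :=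
  {Φ | ∀ X : Fin Φ.numSetVars → Set T, HoldsIn T X Φ.matrix}

/-- The first-order theory of the class of all expansions `(T, β, (P i)_{i ∈ ℕ})` of `(T, β)` by
unary predicates. -/
def expansionTheory {n : ℕ} (T : Set (EuclideanSpace ℝ (Fin n))) :
    Set (betaLang ℕ).Sentence :=
  {φ | ∀ P : ℕ → Set T, HoldsIn T P φ}

/-! ### Hardness and undecidability of sets of finite objects with Gödel numbers -/

/-- `A` is `Σ⁰₁`-hard: every recursively enumerable set of natural numbers is many-one reducible
to `A` by a computable function. -/
def SigmaZeroOneHard {α : Type} (code : α → ℕ) (A : Set α) : Prop :=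
  ∀ p : ℕ → Prop, REPred p →
    ∃ f : ℕ → α, Computable (fun m => code (f m)) ∧ ∀ m, p m ↔ f m ∈ A

/-- `A` is undecidable: no computable function that is given the code of an `a : α` determines
whether `a` belongs to `A`. -/
def IsUndecidable {α : Type} (code : α → ℕ) (A : Set α) : Prop :=
  ¬ ∃ g : ℕ → Bool, Computable g ∧ ∀ a, g (code a) = true ↔ a ∈ A

end AffineBetweenness

namespace AffineBetweenness

/-! ### Grids cut out by two pencils of rays -/

section Grid

variable {n : ℕ}

/-! The regular flat contains a triangle `x`, `x + u`, `x + v` as small as desired. Linear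
completeness puts infinitely many points of the flat on the two sides at `x`; joining them to the
opposite vertices gives two families of cevians, and linear closedness puts all their intersection
points in the flat. These lie in the triangle, hence in `T`. The result is an infinite grid in which
the ray from `p = x + u` determines the row and the ray from `q = x + v` the column
(`ExtendsLinearly.exists_grid`).

A set of grid points is thus a binary relation on a countable set, represented by the diagonal, and
this reading is first-order in betweenness once `p`, `q` and the diagonal are marked by unary
predicates (`realizeIn_toBeta`). Arbitrary marks, even degenerate ones, still define some structure
of binary relations on the marked points.

For a code `c` of a partial recursive function, finitely many axioms, essentially Horn clauses with
totality statements, describe lists of numbers and the graphs of the subcodes of `c`. Consider the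
sentence "the axioms imply that `c` halts on `[m]`". If `c` halts, the computation can be replayed
in every model, so the sentence is true under all markings (`holds_haltingSentence`). If the
sentence is true under all markings, it is true under the one coding the actual lists and graphs,
where it says that `c` halts (`dom_of_holds_haltingSentence`). The number of the sentence is
primitive recursive in `m`, so every recursively enumerable set reduces to either theory, and
undecidability follows from the halting problem. -/

theorem betw_iff_wbtw {a b c : EuclideanSpace ℝ (Fin n)} : Betw a b c ↔ Wbtw ℝ a b c := by
  rw [← dist_add_dist_eq_iff]
  exact eq_comm

/-- `b` and `c` lie on a common ray issuing from `a`. -/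
def OnRay (a b c : EuclideanSpace ℝ (Fin n)) : Prop :=
  Betw a b c ∨ Betw a c b

theorem collinearPts_of_mem_line {a b s t u : EuclideanSpace ℝ (Fin n)} (hs : s ∈ line[ℝ, a, b])
    (ht : t ∈ line[ℝ, a, b]) (hu : u ∈ line[ℝ, a, b]) : CollinearPts s t u := by
  have h : Collinear ℝ ({s, t, u} : Set (EuclideanSpace ℝ (Fin n))) :=
    collinear_triple_of_mem_affineSpan_pair hs ht hu
  simp only [CollinearPts, betw_iff_wbtw]
  rcases h.wbtw_or_wbtw_or_wbtw with h | h | h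
  · exact Or.inl h
  · exact Or.inr (Or.inl h.symm)
  · exact Or.inr (Or.inr h.symm)

theorem mem_line_of_betw {a b s t u : EuclideanSpace ℝ (Fin n)} (hs : s ∈ line[ℝ, a, b])
    (ht : t ∈ line[ℝ, a, b]) (hst : s ≠ t) (h : Betw s u t ∨ Betw s t u) :
    u ∈ line[ℝ, a, b] := by
  have hle : line[ℝ, s, t] ≤ line[ℝ, a, b] := affineSpan_pair_le_of_mem_of_mem hs ht
  apply hle
  simp only [betw_iff_wbtw] at h
  rcases h with h | h
  · exact h.mem_affineSpan
  · obtain ⟨r, -, hr⟩ := h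
    have hr0 : r ≠ 0 := by
      rintro rfl
      exact hst (by simpa using hr)
    have : u = AffineMap.lineMap s t r⁻¹ := by
      rw [← hr]
      simp [AffineMap.lineMap_apply, smul_smul, hr0]
    rw [this]
    exact AffineMap.lineMap_mem_affineSpan_pair _ _ _

/-- Supplies the lines to which completeness and closedness of a flat are applied. -/
theorem isLineIn_inter_line {U : Set (EuclideanSpace ℝ (Fin n))} {a b : EuclideanSpace ℝ (Fin n)}
    (ha : a ∈ U) (hb : b ∈ U) (hab : a ≠ b) : IsLineIn U (U ∩ line[ℝ, a, b]) :=
  ⟨Set.inter_subset_left,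
    ⟨a, ⟨ha, left_mem_affineSpan_pair ℝ a b⟩, b, ⟨hb, right_mem_affineSpan_pair ℝ a b⟩, hab⟩,
    fun _ hs _ ht _ hu => collinearPts_of_mem_line hs.2 ht.2 hu.2,
    fun _ hs _ ht hst _ hu h => ⟨hu, mem_line_of_betw hs.2 ht.2 hst h⟩⟩

theorem isLineIn_univ_line {a b : EuclideanSpace ℝ (Fin n)} (hab : a ≠ b) :
    IsLineIn Set.univ (line[ℝ, a, b] : Set (EuclideanSpace ℝ (Fin n))) := by
  simpa using isLineIn_inter_line (Set.mem_univ a) (Set.mem_univ b) hab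

theorem LinearlyComplete.exists_lineMap_mem {U : Set (EuclideanSpace ℝ (Fin n))}
    (hU : LinearlyComplete U) {a b : EuclideanSpace ℝ (Fin n)} (ha : a ∈ U) (hb : b ∈ U)
    (hab : a ≠ b) {r₁ r₂ : ℝ} (hr : r₁ < r₂) :
    ∃ r, r₁ < r ∧ r < r₂ ∧ AffineMap.lineMap a b r ∈ U := by
  have hd : 0 < dist a b := dist_pos.2 hab
  -- Approximate the point at the midpoint parameter; the radius is half the parameter interval,
  -- scaled by `dist a b`.
  obtain ⟨s, ⟨hsU, hs⟩, hlt⟩ := hU _ _ (isLineIn_inter_line ha hb hab) (isLineIn_univ_line hab)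
    Set.inter_subset_right (AffineMap.lineMap a b ((r₁ + r₂) / 2))
    (AffineMap.lineMap_mem_affineSpan_pair _ _ _) ((r₂ - r₁) / 2 * dist a b)
    (mul_pos (by linarith) hd)
  obtain ⟨r, rfl⟩ := mem_affineSpan_pair_iff_exists_lineMap_eq.1 hs
  rw [dist_lineMap_lineMap, mul_lt_mul_iff_left₀ hd, Real.dist_eq, abs_lt] at hlt
  exact ⟨r, by linarith, by linarith, hsU⟩

theorem LinearlyClosed.mem_of_lineMap_eq {U : Set (EuclideanSpace ℝ (Fin n))}
    (hU : LinearlyClosed U) {a b c d g : EuclideanSpace ℝ (Fin n)} (ha : a ∈ U) (hb : b ∈ U)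
    (hc : c ∈ U) (hd : d ∈ U) (hab : a ≠ b) (hcd : c ≠ d) (hg₁ : g ∈ line[ℝ, a, b])
    (hg₂ : g ∈ line[ℝ, c, d])
    (huniq : ∀ g', g' ∈ line[ℝ, a, b] → g' ∈ line[ℝ, c, d] → g' = g) : g ∈ U := by
  -- Closedness speaks of distinct lines. If the traces on `U` agreed, both `a` and `b` would be
  -- common points and so equal to `g`.
  have hne : U ∩ line[ℝ, a, b] ≠ U ∩ line[ℝ, c, d] := by
    intro h
    have ha' : a ∈ U ∩ line[ℝ, c, d] := h ▸ ⟨ha, left_mem_affineSpan_pair ℝ a b⟩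
    have hb' : b ∈ U ∩ line[ℝ, c, d] := h ▸ ⟨hb, right_mem_affineSpan_pair ℝ a b⟩
    exact hab ((huniq a (left_mem_affineSpan_pair ℝ a b) ha'.2).trans
      (huniq b (right_mem_affineSpan_pair ℝ a b) hb'.2).symm)
  obtain ⟨g', h₁, h₂⟩ := hU _ _ _ _ (isLineIn_inter_line ha hb hab) (isLineIn_inter_line hc hd hcd)
    hne (isLineIn_univ_line hab) (isLineIn_univ_line hcd) Set.inter_subset_right
    Set.inter_subset_right ⟨g, hg₁, hg₂⟩
  rw [← huniq g' h₁.2 h₂.2]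
  exact h₁.1

theorem IsLinearlyRegularFlat.exists_linearIndependent {S : Set (EuclideanSpace ℝ (Fin n))}
    (hS : IsLinearlyRegularFlat 2 S) (x : EuclideanSpace ℝ (Fin n)) :
    ∃ y ∈ S, ∃ z ∈ S, LinearIndependent ℝ ![y - x, z - x] := by
  have key : ∀ v : EuclideanSpace ℝ (Fin n), v ≠ 0 → ∃ y ∈ S, ∀ r : ℝ, y ≠ x + r • v := by
    intro v hv
    by_contra! h
    refine hS.not_subset_smaller 1 rfl
      ⟨_, ⟨![v], x, LinearIndependent.of_subsingleton (0 : Fin 1) (by simpa using hv), rfl⟩, ?_⟩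
    intro y hy
    obtain ⟨r, hr⟩ := h y hy
    exact ⟨fun _ => r, by simpa using hr⟩
  have hn : 0 < n := lt_of_lt_of_le two_pos hS.dim_le
  -- Any nonzero direction serves here: the only aim is a point of `S` other than `x`.
  obtain ⟨y, hy, hyx⟩ := key (EuclideanSpace.single (⟨0, hn⟩ : Fin n) (1 : ℝ)) (by simp)
  have hyx' : y - x ≠ 0 := by
    intro h
    exact hyx 0 (by simpa [sub_eq_zero] using h)
  obtain ⟨z, hz, hzx⟩ := key _ hyx'
  refine ⟨y, hy, z, hz, (LinearIndependent.pair_iff' hyx').2 fun r hr => hzx r ?_⟩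
  rw [hr]
  abel

/-- Two points of `U` close to `x`, spanning with it a triangle. -/
theorem IsLinearlyRegularFlat.exists_linearIndependent_near {S : Set (EuclideanSpace ℝ (Fin n))}
    (hS : IsLinearlyRegularFlat 2 S) {x : EuclideanSpace ℝ (Fin n)} (hx : x ∈ S) {ε : ℝ}
    (hε : 0 < ε) :
    ∃ u v : EuclideanSpace ℝ (Fin n), x + u ∈ S ∧ x + v ∈ S ∧ ‖u‖ < ε ∧ ‖v‖ < ε ∧
      LinearIndependent ℝ ![u, v] := by
  obtain ⟨y, hy, z, hz, hyz⟩ := hS.exists_linearIndependent x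
  have key : ∀ w ∈ S, w - x ≠ 0 → ∃ r : ℝ, r ≠ 0 ∧ x + r • (w - x) ∈ S ∧ ‖r • (w - x)‖ < ε := by
    intro w hw hwx
    have hpos : 0 < ‖w - x‖ := norm_pos_iff.2 hwx
    obtain ⟨r, h₁, h₂, h₃⟩ := hS.complete.exists_lineMap_mem hx hw
      (fun h => hwx (by rw [h, sub_self])) (div_pos hε hpos)
    refine ⟨r, h₁.ne', ?_, ?_⟩
    · simpa [AffineMap.lineMap_apply, add_comm] using h₃
    · rw [norm_smul, Real.norm_of_nonneg h₁.le]
      exact (lt_div_iff₀ hpos).1 h₂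
  obtain ⟨r, hr, hr₁, hr₂⟩ := key y hy (hyz.ne_zero 0)
  obtain ⟨s, hs, hs₁, hs₂⟩ := key z hz (hyz.ne_zero 1)
  refine ⟨_, _, hr₁, hs₁, hr₂, hs₂, ?_⟩
  rw [LinearIndependent.pair_iff] at hyz ⊢
  intro a b hab
  rw [smul_smul, smul_smul] at hab
  have := hyz _ _ hab
  simpa [hr, hs] using this

/-- The parameters are picked from the pairwise disjoint intervals between `1 / (i + 2)` and `1 / (i
+ 1)`. -/
theorem exists_injective_lineMap_mem {U : Set (EuclideanSpace ℝ (Fin n))}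
    (hU : LinearlyComplete U) {a b : EuclideanSpace ℝ (Fin n)} (ha : a ∈ U) (hb : b ∈ U)
    (hab : a ≠ b) :
    ∃ s : ℕ → ℝ, Function.Injective s ∧
      ∀ i, 0 < s i ∧ s i < 1 ∧ AffineMap.lineMap a b (s i) ∈ U := by
  have h : ∀ i : ℕ, ∃ r : ℝ, 1 / ((i : ℝ) + 2) < r ∧ r < 1 / ((i : ℝ) + 1) ∧
      AffineMap.lineMap a b r ∈ U := fun i =>
    hU.exists_lineMap_mem ha hb hab (one_div_lt_one_div_of_lt (by positivity) (by linarith))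
  choose s h₁ h₂ h₃ using h
  refine ⟨s, (strictAnti_nat_of_succ_lt fun i => ?_).injective, fun i => ⟨?_, ?_, h₃ i⟩⟩
  · refine (h₂ (i + 1)).trans ?_
    push_cast
    rw [add_assoc, one_add_one_eq_two]
    exact h₁ i
  · exact lt_trans (by positivity) (h₁ i)
  · refine (h₂ i).trans_le ?_
    rw [div_le_one (by positivity)]
    linarith [Nat.cast_nonneg (α := ℝ) i]

/-- Points seen from `x + u` under the slopes `s` and `s'` are on a common ray iff `s = s'`. -/
theorem onRay_iff_slope_eq {x u v : EuclideanSpace ℝ (Fin n)} (huv : LinearIndependent ℝ ![u, v])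
    {s s' c c' : ℝ} (hc : 0 < c) (hc' : 0 < c') :
    OnRay (x + u) (x + u + c • (s • v - u)) (x + u + c' • (s' • v - u)) ↔ s = s' := by
  rw [LinearIndependent.pair_iff] at huv
  -- Comparing the coefficients of `u` and `v` gives `c = r c'` and `c s = r c' s'`, hence `c (s -
  -- s') = 0`.
  have key : ∀ {s s' c c' : ℝ}, 0 < c →
      Wbtw ℝ (x + u) (x + u + c • (s • v - u)) (x + u + c' • (s' • v - u)) → s = s' := by
    intro s s' c c' hc h
    obtain ⟨r, -, hr⟩ := h
    have h0 : (c - r * c') • u + (r * c' * s' - c * s) • v = 0 := by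
      simp only [AffineMap.lineMap_apply, vsub_eq_sub, vadd_eq_add, add_sub_cancel_left] at hr
      linear_combination (norm := module) hr
    obtain ⟨h₁, h₂⟩ := huv _ _ h0
    have : c * (s - s') = 0 := by linear_combination (-s') * h₁ - h₂
    rcases mul_eq_zero.1 this with h | h
    · exact absurd h hc.ne'
    · linarith
  have key' : ∀ {s c c' : ℝ}, 0 < c → 0 < c' → c ≤ c' →
      Wbtw ℝ (x + u) (x + u + c • (s • v - u)) (x + u + c' • (s • v - u)) := by
    intro s c c' hc hc' h
    refine ⟨c / c', ⟨by positivity, (div_le_one hc').2 h⟩, ?_⟩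
    simp only [AffineMap.lineMap_apply, vsub_eq_sub, vadd_eq_add, add_sub_cancel_left, smul_smul]
    rw [div_mul_cancel₀ _ hc'.ne', add_comm]
  simp only [OnRay, betw_iff_wbtw]
  constructor
  · rintro (h | h)
    · exact key hc h
    · exact (key hc' h).symm
  · rintro rfl
    rcases le_total c c' with h | h
    · exact Or.inl (key' hc hc' h)
    · exact Or.inr (key' hc' hc h)

/-- This identity and the next match the `u`- and `v`-coordinates of the intersection of two
cevians, computed along either cevian. -/
theorem one_sub_cevian_coeff {s t : ℝ} (h : 1 - s * t ≠ 0) :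
    1 - (1 - t) / (1 - s * t) = t * ((1 - s) / (1 - s * t)) := by
  rw [← mul_div_assoc, eq_div_iff h, sub_mul, div_mul_cancel₀ _ h]
  ring

theorem mul_cevian_coeff {s t : ℝ} (h : 1 - s * t ≠ 0) :
    s * ((1 - t) / (1 - s * t)) = 1 - (1 - s) / (1 - s * t) := by
  rw [← mul_div_assoc, div_eq_iff h, sub_mul, div_mul_cancel₀ _ h]
  ring

/-- The intersection point of two cevians of the triangle `x`, `x + u`, `x + v`. -/
theorem cevian_inter_mem {S : Set (EuclideanSpace ℝ (Fin n))} (hS : LinearlyClosed S)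
    {x u v : EuclideanSpace ℝ (Fin n)} (huv : LinearIndependent ℝ ![u, v]) (hu : x + u ∈ S)
    (hv : x + v ∈ S) {s t : ℝ} (hst : s * t ≠ 1) (hs : x + s • v ∈ S) (ht : x + t • u ∈ S) :
    x + u + ((1 - t) / (1 - s * t)) • (s • v - u) ∈ S := by
  rw [LinearIndependent.pair_iff] at huv
  have hst' : 1 - s * t ≠ 0 := sub_ne_zero.2 hst.symm
  have h₁ : x + u ≠ x + s • v := by
    intro h
    have := (huv 1 (-s) (by rw [add_left_cancel h]; module)).1
    norm_num at this
  have h₂ : x + v ≠ x + t • u := by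
    intro h
    have := (huv (-t) 1 (by rw [add_left_cancel h]; module)).2
    norm_num at this
  refine hS.mem_of_lineMap_eq hu hs hv ht h₁ h₂ ?_ ?_ ?_
  · rw [mem_affineSpan_pair_iff_exists_lineMap_eq]
    refine ⟨(1 - t) / (1 - s * t), ?_⟩
    simp only [AffineMap.lineMap_apply, vsub_eq_sub, vadd_eq_add]
    module
  · rw [mem_affineSpan_pair_iff_exists_lineMap_eq]
    refine ⟨(1 - s) / (1 - s * t), ?_⟩
    simp only [AffineMap.lineMap_apply, vsub_eq_sub, vadd_eq_add]
    linear_combination (norm := module)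
      -one_sub_cevian_coeff hst' • u - mul_cevian_coeff hst' • v
  · intro g' hg₁ hg₂
    obtain ⟨r₁, rfl⟩ := mem_affineSpan_pair_iff_exists_lineMap_eq.1 hg₁
    obtain ⟨r₂, hr⟩ := mem_affineSpan_pair_iff_exists_lineMap_eq.1 hg₂
    simp only [AffineMap.lineMap_apply, vsub_eq_sub, vadd_eq_add] at hr ⊢
    obtain ⟨e₁, e₂⟩ := huv (r₂ * t - (1 - r₁)) ((1 - r₂) - r₁ * s)
      (by linear_combination (norm := module) hr)
    -- Eliminating `r₂` leaves a linear equation for `r₁` with coefficient `1 - s * t`, nonzero by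
    -- assumption.
    have : r₁ = (1 - t) / (1 - s * t) := by
      rw [eq_div_iff hst']
      linear_combination e₁ + t * e₂
    rw [this]
    module

/-- A set that extends linearly in the plane contains a grid whose rows and columns are cut out by
the rays issuing from two points. -/
theorem ExtendsLinearly.exists_grid {T : Set (EuclideanSpace ℝ (Fin n))}
    (hT : ExtendsLinearly 2 T) :
    ∃ (p q : T) (g : ℕ → ℕ → T),
      (∀ i j k l, OnRay (p : EuclideanSpace ℝ (Fin n)) (g i j) (g k l) ↔ i = k) ∧
      ∀ i j k l, OnRay (q : EuclideanSpace ℝ (Fin n)) (g i j) (g k l) ↔ j = l := by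
  obtain ⟨S, hS, ε, hε, x, ⟨hxS, -⟩, hsub⟩ := hT
  obtain ⟨u, v, hu, hv, hu', hv', huv⟩ := hS.exists_linearIndependent_near hxS hε
  have hmem : ∀ w, x + w ∈ S → ‖w‖ < ε → x + w ∈ T := fun w h₁ h₂ => hsub ⟨h₁, by simpa using h₂⟩
  obtain ⟨s, hs, hs'⟩ := exists_injective_lineMap_mem hS.complete hxS hv
    (by simpa using huv.ne_zero 1)
  obtain ⟨t, ht, ht'⟩ := exists_injective_lineMap_mem hS.complete hxS hu
    (by simpa using huv.ne_zero 0)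
  simp only [AffineMap.lineMap_apply, vsub_eq_sub, vadd_eq_add, add_sub_cancel_left,
    add_comm _ x] at hs' ht'
  have hst : ∀ i j, 0 < 1 - s i * t j := fun i j => by
    nlinarith [hs' i, ht' j]
  have hc : ∀ i j, 0 < (1 - t j) / (1 - s i * t j) := fun i j =>
    div_pos (by linarith [(ht' j).2.1]) (hst i j)
  have hd : ∀ i j, 0 < (1 - s i) / (1 - s i * t j) := fun i j =>
    div_pos (by linarith [(hs' i).2.1]) (hst i j)
  -- The same point seen from the other vertex, so that the slope criterion for rays also applies at
  -- `x + v`.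
  have hswap : ∀ i j, x + u + ((1 - t j) / (1 - s i * t j)) • (s i • v - u) =
      x + v + ((1 - s i) / (1 - s i * t j)) • (t j • u - v) := fun i j => by
    have := (hst i j).ne'
    linear_combination (norm := module) one_sub_cevian_coeff this • u + mul_cevian_coeff this • v
  have hgT : ∀ i j, x + u + ((1 - t j) / (1 - s i * t j)) • (s i • v - u) ∈ T := fun i j => by
    have h := cevian_inter_mem hS.closed huv hu hv (by linarith [hst i j]) (hs' i).2.2 (ht' j).2.2
    rw [add_assoc] at h ⊢
    refine hmem _ h ?_
    have h1 := (hst i j)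
    have e : u + ((1 - t j) / (1 - s i * t j)) • (s i • v - u) =
        (t j * ((1 - s i) / (1 - s i * t j))) • u + (s i * ((1 - t j) / (1 - s i * t j))) • v := by
      linear_combination (norm := module) one_sub_cevian_coeff h1.ne' • u
    rw [e]
    have hα := mul_pos (ht' j).1 (hd i j)
    have hβ := mul_pos (hs' i).1 (hc i j)
    -- The coordinates of the point are positive with sum at most `1`, since the difference has
    -- numerator `(1 - s i) * (1 - t j)`. So the point is in the triangle, and its distance from `x`
    -- is below `ε`.
    have hαβ : t j * ((1 - s i) / (1 - s i * t j)) + s i * ((1 - t j) / (1 - s i * t j)) ≤ 1 := by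
      rw [← mul_div_assoc, ← mul_div_assoc, ← add_div, div_le_one h1]
      nlinarith [mul_pos (sub_pos.2 (hs' i).2.1) (sub_pos.2 (ht' j).2.1)]
    refine (norm_add_le _ _).trans_lt ?_
    rw [norm_smul, norm_smul, Real.norm_of_nonneg hα.le, Real.norm_of_nonneg hβ.le]
    nlinarith [mul_lt_mul_of_pos_left hu' hα, mul_lt_mul_of_pos_left hv' hβ]
  refine ⟨⟨_, hmem u hu hu'⟩, ⟨_, hmem v hv hv'⟩, fun i j => ⟨_, hgT i j⟩, fun i j k l => ?_,
    fun i j k l => ?_⟩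
  · exact (onRay_iff_slope_eq huv (hc i j) (hc k l)).trans hs.eq_iff
  · show OnRay (x + v) (x + u + _) (x + u + _) ↔ _
    rw [hswap, hswap]
    exact (onRay_iff_slope_eq (LinearIndependent.pair_symm_iff.1 huv) (hd i j) (hd k l)).trans
      ht.eq_iff

end Grid

/-! ### First-order formulas over binary relations, and their translation -/

section Translation

/-- First-order formulas in the variables `0, …, k - 1` over binary relation symbols `r : κ`. -/
inductive RelFormula (κ : Type) : ℕ → Type
  | bot {k : ℕ} : RelFormula κ k
  | rel {k : ℕ} (r : κ) (i j : Fin k) : RelFormula κ k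
  | imp {k : ℕ} (φ ψ : RelFormula κ k) : RelFormula κ k
  | all {k : ℕ} (φ : RelFormula κ (k + 1)) : RelFormula κ k

namespace RelFormula

variable {κ ι D : Type}

/-- Truth of a formula in the structure `(D, R)`. -/
def Holds (R : κ → D → D → Prop) : {k : ℕ} → RelFormula κ k → (Fin k → D) → Prop
  | _, bot, _ => False
  | _, rel r i j, v => R r (v i) (v j)
  | _, imp φ ψ, v => φ.Holds R v → ψ.Holds R v
  | _, all φ, v => ∀ d : D, φ.Holds R (Fin.snoc v d)

/-- Conjunction. -/
def and {k : ℕ} (φ ψ : RelFormula κ k) : RelFormula κ k :=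
  ((φ.imp (ψ.imp bot)).imp bot)

/-- Existential quantification. -/
def ex {k : ℕ} (φ : RelFormula κ (k + 1)) : RelFormula κ k :=
  (all (φ.imp bot)).imp bot

@[simp]
theorem holds_bot (R : κ → D → D → Prop) {k : ℕ} (v : Fin k → D) :
    (bot : RelFormula κ k).Holds R v ↔ False := Iff.rfl

@[simp]
theorem holds_rel (R : κ → D → D → Prop) {k : ℕ} (r : κ) (i j : Fin k) (v : Fin k → D) :
    (rel r i j).Holds R v ↔ R r (v i) (v j) := Iff.rfl

@[simp]
theorem holds_imp (R : κ → D → D → Prop) {k : ℕ} (φ ψ : RelFormula κ k) (v : Fin k → D) :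
    (imp φ ψ).Holds R v ↔ (φ.Holds R v → ψ.Holds R v) := Iff.rfl

@[simp]
theorem holds_all (R : κ → D → D → Prop) {k : ℕ} (φ : RelFormula κ (k + 1)) (v : Fin k → D) :
    (all φ).Holds R v ↔ ∀ d : D, φ.Holds R (Fin.snoc v d) := Iff.rfl

@[simp]
theorem holds_and (R : κ → D → D → Prop) {k : ℕ} (φ ψ : RelFormula κ k) (v : Fin k → D) :
    (φ.and ψ).Holds R v ↔ φ.Holds R v ∧ ψ.Holds R v := by
  simp [RelFormula.and]

@[simp]
theorem holds_ex (R : κ → D → D → Prop) {k : ℕ} (φ : RelFormula κ (k + 1)) (v : Fin k → D) :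
    (ex φ).Holds R v ↔ ∃ d : D, φ.Holds R (Fin.snoc v d) := by
  simp [ex]

/-- The variable `i` as a term. -/
def varTerm {k : ℕ} (i : Fin k) : (betaLang ι).Term (Empty ⊕ Fin k) :=
  .var (Sum.inr i)

/-- The atomic formula `β i j l`. -/
def betaAtom {k : ℕ} (i j l : Fin k) : (betaLang ι).BoundedFormula Empty k :=
  .rel (l := 3) (BetaRel.beta : BetaRel ι 3) ![varTerm i, varTerm j, varTerm l]

/-- The atomic formula `P r i`. -/
def predAtom {k : ℕ} (r : ι) (i : Fin k) : (betaLang ι).BoundedFormula Empty k :=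
  .rel (l := 1) (BetaRel.pred r : BetaRel ι 1) ![varTerm i]

/-- `j` and `l` lie on a common ray issuing from `i`. -/
def rayFormula {k : ℕ} (i j l : Fin k) : (betaLang ι).BoundedFormula Empty k :=
  .imp (.imp (betaAtom i j l) .falsum) (betaAtom i l j)

/-- Some point marked by `r` is on the ray from a point marked by `a` through `i` and on the ray
from a point marked by `b` through `j`. -/
def gridAtom {k : ℕ} (a b r : ι) (i j : Fin k) : (betaLang ι).BoundedFormula Empty k :=
  .imp (.all (.all (.all
    (.imp (predAtom a (Fin.last k).castSucc.castSucc)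
      (.imp (predAtom b (Fin.last (k + 1)).castSucc)
        (.imp (predAtom r (Fin.last (k + 2)))
          (.imp (rayFormula (Fin.last k).castSucc.castSucc i.castSucc.castSucc.castSucc
              (Fin.last (k + 2)))
            (.imp (rayFormula (Fin.last (k + 1)).castSucc j.castSucc.castSucc.castSucc
              (Fin.last (k + 2))) .falsum)))))))) .falsum

/-- Translation into the language of betweenness. The pencils with centres marked by `a` and `b`
provide coordinates, and the quantifiers range over the points marked by `d`. -/
def toBeta (h : κ → ι) (a b d : ι) : {k : ℕ} → RelFormula κ k → (betaLang ι).BoundedFormula Empty k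
  | _, bot => .falsum
  | _, rel r i j => gridAtom a b (h r) i j
  | _, imp φ ψ => .imp (φ.toBeta h a b d) (ψ.toBeta h a b d)
  | k, all φ => .all (.imp (predAtom d (Fin.last k)) (φ.toBeta h a b d))

variable {n : ℕ} {T : Set (EuclideanSpace ℝ (Fin n))}

/-- The binary relation coded by the points of `T` marked by `r`. -/
def GridRel (X : ι → Set T) (a b r : ι) (x y : T) : Prop :=
  ∃ p ∈ X a, ∃ q ∈ X b, ∃ g ∈ X r, OnRay (p : EuclideanSpace ℝ (Fin n)) x g ∧
    OnRay (q : EuclideanSpace ℝ (Fin n)) y g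

/-- Realization of bounded formulas in `(T, β, X)`. -/
def RealizeIn (X : ι → Set T) {k : ℕ} (φ : (betaLang ι).BoundedFormula Empty k) (v : Fin k → T) :
    Prop :=
  letI := expansion T X
  φ.Realize Empty.elim v

theorem realizeIn_falsum (X : ι → Set T) {k : ℕ} (v : Fin k → T) :
    RealizeIn X .falsum v ↔ False := Iff.rfl

theorem realizeIn_imp (X : ι → Set T) {k : ℕ} (φ ψ : (betaLang ι).BoundedFormula Empty k)
    (v : Fin k → T) : RealizeIn X (.imp φ ψ) v ↔ (RealizeIn X φ v → RealizeIn X ψ v) := Iff.rfl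

theorem realizeIn_all (X : ι → Set T) {k : ℕ} (φ : (betaLang ι).BoundedFormula Empty (k + 1))
    (v : Fin k → T) : RealizeIn X (.all φ) v ↔ ∀ x, RealizeIn X φ (Fin.snoc v x) := Iff.rfl

theorem realizeIn_predAtom (X : ι → Set T) {k : ℕ} (r : ι) (i : Fin k) (v : Fin k → T) :
    RealizeIn X (predAtom r i) v ↔ v i ∈ X r := Iff.rfl

theorem realizeIn_rayFormula (X : ι → Set T) {k : ℕ} (i j l : Fin k) (v : Fin k → T) :
    RealizeIn X (rayFormula i j l) v ↔ OnRay (v i : EuclideanSpace ℝ (Fin n)) (v j) (v l) := by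
  rw [OnRay, or_iff_not_imp_left]
  rfl

theorem realizeIn_gridAtom (X : ι → Set T) {k : ℕ} (a b r : ι) (i j : Fin k) (v : Fin k → T) :
    RealizeIn X (gridAtom a b r i j) v ↔ GridRel X a b r (v i) (v j) := by
  simp only [gridAtom, realizeIn_imp, realizeIn_all, realizeIn_falsum, realizeIn_predAtom,
    realizeIn_rayFormula, Fin.snoc_castSucc, Fin.snoc_last, GridRel]
  constructor
  · intro h
    by_contra hc
    exact h fun p q g hp hq hg h₁ h₂ => hc ⟨p, hp, q, hq, g, hg, h₁, h₂⟩
  · rintro ⟨p, hp, q, hq, g, hg, h₁, h₂⟩ h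
    exact h p q g hp hq hg h₁ h₂

/-- Relation formulas have no equality, so `e` need not be injective; it only has to cover the
marked points, over which the translated quantifiers range. -/
theorem realizeIn_toBeta {X : ι → Set T} {h : κ → ι} {a b d : ι} {R : κ → D → D → Prop}
    {e : D → T} (he : Set.range e = X d)
    (hR : ∀ r x y, R r x y ↔ GridRel X a b (h r) (e x) (e y)) {k : ℕ} (φ : RelFormula κ k)
    (v : Fin k → D) : RealizeIn X (φ.toBeta h a b d) (e ∘ v) ↔ φ.Holds R v := by
  induction φ with
  | bot => rfl
  | rel r i j => simp [toBeta, realizeIn_gridAtom, hR]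
  | imp φ ψ ih₁ ih₂ => simp only [toBeta, realizeIn_imp, holds_imp, ih₁, ih₂]
  | all φ ih =>
    simp only [toBeta, realizeIn_all, realizeIn_imp, realizeIn_predAtom, Fin.snoc_last, holds_all,
      ← he, Set.forall_mem_range, ← ih, Fin.comp_snoc]

end RelFormula

end Translation

/-! ### Horn theories of partial recursive functions -/

section Machine

open Turing.ToPartrec (Code)

namespace RelFormula

variable {κ D : Type}

/-- Universal closure. -/
def closure : {k : ℕ} → RelFormula κ k → RelFormula κ 0
  | 0, φ => φ
  | _ + 1, φ => closure (all φ)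

theorem holds_closure (R : κ → D → D → Prop) {k : ℕ} (φ : RelFormula κ k) (w : Fin 0 → D) :
    φ.closure.Holds R w ↔ ∀ v : Fin k → D, φ.Holds R v := by
  induction k with
  | zero => exact ⟨fun h v => Subsingleton.elim w v ▸ h, fun h => h w⟩
  | succ k ih =>
    rw [closure, ih]
    exact ⟨fun h v => Fin.snoc_init_self v ▸ h (Fin.init v) (v (Fin.last k)), fun h v d => h _⟩

/-- The universal Horn clause with the given body and head. -/
def clause (k : ℕ) (body : List (κ × Fin k × Fin k)) (head : κ × Fin k × Fin k) :
    RelFormula κ 0 :=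
  closure (body.foldr (fun a φ => (rel a.1 a.2.1 a.2.2).imp φ) (rel head.1 head.2.1 head.2.2))

theorem holds_foldr_imp {α : Type} (f : α → RelFormula κ 0) (R : κ → D → D → Prop) (l : List α)
    (ψ : RelFormula κ 0) (w : Fin 0 → D) :
    (l.foldr (fun a φ => (f a).imp φ) ψ).Holds R w ↔
      ((∀ a ∈ l, (f a).Holds R w) → ψ.Holds R w) := by
  induction l with
  | nil => simp
  | cons a l ih => simp [ih]

end RelFormula

open RelFormula

/-- Relation symbols of the theory of a recursive function on lists. The first three are reserved
for the coding of the theory by points. -/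
inductive Sym
  | dom
  | left
  | right
  | nil
  | zero
  | succ
  | tail
  | head
  | graph (c : Code)

/-- The axioms for lists of natural numbers. -/
def listAxioms : List (RelFormula Sym 0) :=
  [ex (rel .nil 0 0), all (ex (rel .zero 0 1)), all (ex (rel .succ 0 1)),
    clause 1 [(.nil, 0, 0)] (.tail, 0, 0),
    clause 2 [(.zero, 0, 1)] (.tail, 1, 0),
    clause 3 [(.succ, 0, 1), (.tail, 0, 2)] (.tail, 1, 2),
    clause 4 [(.zero, 0, 1), (.zero, 2, 3)] (.head, 1, 3),
    clause 3 [(.zero, 0, 1), (.nil, 2, 2)] (.head, 1, 2),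
    clause 4 [(.head, 0, 1), (.succ, 0, 2), (.succ, 1, 3)] (.head, 2, 3)]

/-- The axioms for the graph of `c.eval`. -/
def codeAxioms : Code → List (RelFormula Sym 0)
  | .zero' => [clause 2 [(.zero, 0, 1)] (.graph .zero', 0, 1)]
  | .succ => [clause 4 [(.succ, 0, 1), (.head, 2, 1), (.tail, 2, 3), (.nil, 3, 3)]
      (.graph .succ, 0, 2)]
  | .tail => [clause 2 [(.tail, 0, 1)] (.graph .tail, 0, 1)]
  | .cons f fs => clause 4 [(.graph f, 0, 1), (.graph fs, 0, 2), (.tail, 3, 2), (.head, 3, 1)]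
      (.graph (.cons f fs), 0, 3) :: (codeAxioms f ++ codeAxioms fs)
  | .comp f g => clause 3 [(.graph g, 0, 1), (.graph f, 1, 2)] (.graph (.comp f g), 0, 2) ::
      (codeAxioms f ++ codeAxioms g)
  | .case f g =>
      clause 2 [(.nil, 0, 0), (.graph f, 0, 1)] (.graph (.case f g), 0, 1) ::
      clause 3 [(.zero, 0, 1), (.graph f, 0, 2)] (.graph (.case f g), 1, 2) ::
      clause 3 [(.succ, 0, 1), (.head, 0, 0), (.graph g, 0, 2)] (.graph (.case f g), 1, 2) ::
      (codeAxioms f ++ codeAxioms g)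
  | .fix f =>
      clause 2 [(.graph f, 0, 1), (.nil, 1, 1)] (.graph (.fix f), 0, 1) ::
      clause 3 [(.graph f, 0, 1), (.zero, 2, 1)] (.graph (.fix f), 0, 2) ::
      clause 5 [(.graph f, 0, 1), (.succ, 2, 1), (.tail, 1, 3), (.graph (.fix f), 3, 4)]
        (.graph (.fix f), 0, 4) :: codeAxioms f

/-- The formula saying that `c` halts on the list obtained from the last variable by applying the
successor `m` times. -/
def haltsFrom (c : Code) : ℕ → (j : ℕ) → RelFormula Sym (j + 1)
  | 0, j => ex (rel (.graph c) (Fin.last j).castSucc (Fin.last (j + 1)))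
  | m + 1, j => ex ((rel .succ (Fin.last j).castSucc (Fin.last (j + 1))).and (haltsFrom c m (j + 1)))

/-- The sentence saying that `c` halts on the list `[m]`. -/
def haltsOn (c : Code) (m : ℕ) : RelFormula Sym 0 :=
  ex ((rel .nil 0 0).and (ex ((rel .zero 0 1).and (haltsFrom c m 1))))

/-- The sentence saying that the axioms imply that `c` halts on the list `[m]`. -/
def haltingSentence (c : Code) (m : ℕ) : RelFormula Sym 0 :=
  (listAxioms ++ codeAxioms c).foldr (fun φ ψ => φ.imp ψ) (haltsOn c m)

/-! ### Every model of the axioms replays the computation -/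

section Soundness

variable {D : Type} {R : Sym → D → D → Prop} {w : Fin 0 → D}

/-- Realization of lists, given realizations of the empty list and of the two constructors. -/
def listVal (a : D) (z s : D → D) : List ℕ → D
  | [] => a
  | n :: v => s^[n] (z (listVal a z s v))

/-- `e` realizes lists by elements of `(D, R)`. -/
structure IsListRealization (R : Sym → D → D → Prop) (e : List ℕ → D) : Prop where
  nil : R .nil (e []) (e [])
  zero : ∀ v, R .zero (e v) (e (0 :: v))
  succ : ∀ n v, R .succ (e (n :: v)) (e ((n + 1) :: v))
  succ_nil : ∃ x, R .succ (e []) x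
  tail : ∀ v, R .tail (e v) (e v.tail)
  head : ∀ n u v, v.headI = n → R .head (e (n :: u)) (e v)
  head_succ : ∀ x y x' y', R .head x y → R .succ x x' → R .succ y y' → R .head x' y'

/-- Choosing witnesses for the existential axioms gives an empty list and two constructors, and `e`
is defined from these by recursion. Different lists may get the same value, which does no harm
because the clauses are only used positively. -/
theorem exists_isListRealization (h : ∀ φ ∈ listAxioms, φ.Holds R w) :
    ∃ e, IsListRealization R e := by
  simp only [listAxioms, List.forall_mem_cons, clause, holds_closure, List.foldr_cons,
    List.foldr_nil, holds_imp, holds_rel, holds_ex, holds_all, List.not_mem_nil, false_implies,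
    implies_true, and_true] at h
  obtain ⟨⟨a, h₁⟩, h₂, h₃, h₄, h₅, h₆, h₇, h₈, h₉⟩ := h
  choose z hz using h₂
  choose s hs using h₃
  let e := listVal a z s
  have ha : R .nil (e []) (e []) := h₁
  have hz' : ∀ v, R .zero (e v) (e (0 :: v)) := fun v => hz _
  have hs' : ∀ n v, R .succ (e (n :: v)) (e ((n + 1) :: v)) := fun n v => by
    simp only [e, listVal, Function.iterate_succ_apply']
    exact hs _
  have h9 : ∀ x y x' y', R .head x y → R .succ x x' → R .succ y y' → R .head x' y' :=
    fun x y x' y' => h₉ ![x, y, x', y']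
  refine ⟨e, ha, hz', hs', ⟨_, hs a⟩, fun v => ?_, fun n u v => ?_, h9⟩
  · rcases v with - | ⟨n, v⟩
    · exact h₄ ![e []] ha
    · induction n with
      | zero => exact h₅ ![e v, e (0 :: v)] (hz' v)
      | succ n ih => exact h₆ ![e (n :: v), e ((n + 1) :: v), e v] (hs' n v) ih
  · rcases v with - | ⟨k, v⟩
    · rintro rfl
      exact h₈ ![e u, e (0 :: u), e []] (hz' u) ha
    · rintro rfl
      rw [List.headI_cons]
      induction k with
      | zero => exact h₇ ![e u, e (0 :: u), e v, e (0 :: v)] (hz' u) (hz' v)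
      | succ k ih => exact h9 _ _ _ _ ih (hs' k u) (hs' k v)

/-- Induction on the code: each clause is one evaluation rule. The graph relation may contain other
pairs as well; only the true ones are needed. -/
theorem IsListRealization.graph {e : List ℕ → D} (he : IsListRealization R e) {c : Code}
    (h : ∀ φ ∈ codeAxioms c, φ.Holds R w) {u v : List ℕ} (huv : v ∈ c.eval u) :
    R (.graph c) (e u) (e v) := by
  induction c generalizing u v with
  | zero' =>
    simp only [codeAxioms, List.forall_mem_cons, clause, holds_closure, List.foldr_cons,
      List.foldr_nil, holds_imp, holds_rel, List.not_mem_nil, false_implies, implies_true,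
      and_true] at h
    simp at huv
    subst huv
    exact h ![e u, e (0 :: u)] (he.zero u)
  | succ =>
    simp only [codeAxioms, List.forall_mem_cons, clause, holds_closure, List.foldr_cons,
      List.foldr_nil, holds_imp, holds_rel, List.not_mem_nil, false_implies, implies_true,
      and_true] at h
    simp at huv
    subst huv
    -- For `u = []` the element `x` need not be a value of `e`. The clause for `.succ` only uses it
    -- as a carrier of the head, which `head_succ` compares with that of `e [u.headI + 1]`.
    obtain ⟨x, hx⟩ : ∃ x, R .succ (e u) x := by
      rcases u with - | ⟨n, u⟩
      · exact he.succ_nil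
      · exact ⟨_, he.succ n u⟩
    exact h ![e u, x, e [u.headI + 1], e []] hx
      (he.head_succ _ _ _ _ (he.head u.headI [] u rfl) (he.succ _ _) hx) (he.tail _) he.nil
  | tail =>
    simp only [codeAxioms, List.forall_mem_cons, clause, holds_closure, List.foldr_cons,
      List.foldr_nil, holds_imp, holds_rel, List.not_mem_nil, false_implies, implies_true,
      and_true] at h
    simp at huv
    subst huv
    exact h ![e u, e u.tail] (he.tail u)
  | cons f fs ih₁ ih₂ =>
    simp only [codeAxioms, List.forall_mem_cons, List.forall_mem_append, clause, holds_closure,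
      List.foldr_cons, List.foldr_nil, holds_imp, holds_rel] at h
    simp at huv
    obtain ⟨a, ha, b, hb, rfl⟩ := huv
    exact h.1 ![e u, e a, e b, e (a.headI :: b)] (ih₁ h.2.1 ha) (ih₂ h.2.2 hb) (he.tail _)
      (he.head _ _ _ rfl)
  | comp f g ih₁ ih₂ =>
    simp only [codeAxioms, List.forall_mem_cons, List.forall_mem_append, clause, holds_closure,
      List.foldr_cons, List.foldr_nil, holds_imp, holds_rel] at h
    rw [Code.comp_eval] at huv
    obtain ⟨a, ha, hb⟩ := Part.mem_bind_iff.1 huv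
    exact h.1 ![e u, e a, e v] (ih₂ h.2.2 ha) (ih₁ h.2.1 hb)
  | case f g ih₁ ih₂ =>
    simp only [codeAxioms, List.forall_mem_cons, List.forall_mem_append, clause, holds_closure,
      List.foldr_cons, List.foldr_nil, holds_imp, holds_rel] at h
    simp at huv
    obtain ⟨h₁, h₂, h₃, hf, hg⟩ := h
    rcases u with - | ⟨_ | n, u⟩
    · exact h₁ ![e [], e v] he.nil (ih₁ hf huv)
    · exact h₂ ![e u, e (0 :: u), e v] (he.zero u) (ih₁ hf huv)
    · exact h₃ ![e (n :: u), e ((n + 1) :: u), e v] (he.succ n u) (he.head _ _ _ rfl) (ih₂ hg huv)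
  | fix f ih =>
    simp only [codeAxioms, List.forall_mem_cons, clause, holds_closure,
      List.foldr_cons, List.foldr_nil, holds_imp, holds_rel] at h
    obtain ⟨h₁, h₂, h₃, hf⟩ := h
    rw [Code.fix_eval] at huv
    -- Induction along the terminating loop: the first case is an exit, with an empty list or head
    -- `0`, the second a further round.
    refine PFun.fixInduction' (C := fun u => R (.graph (.fix f)) (e u) (e v)) huv ?_ ?_
    · intro u hu
      simp only [Part.mem_map_iff] at hu
      obtain ⟨r, hr, hr'⟩ := hu
      rcases r with - | ⟨_ | n, r⟩
      · simp at hr'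
        subst hr'
        exact h₁ ![e u, e []] (ih hf hr) he.nil
      · simp at hr'
        subst hr'
        exact h₂ ![e u, e (0 :: r), e r] (ih hf hr) (he.zero r)
      · simp at hr'
    · intro u u' _ hu ihu
      simp only [Part.mem_map_iff] at hu
      obtain ⟨r, hr, hr'⟩ := hu
      rcases r with - | ⟨_ | n, r⟩
      · simp at hr'
      · simp at hr'
      · simp at hr'
        subst hr'
        exact h₃ ![e u, e ((n + 1) :: r), e (n :: r), e r, e v] (ih hf hr) (he.succ n r)
          (he.tail _) ihu

/-- The witnesses for the nested existential quantifiers are `e [n + 1]`, `e [n + 2]`, and so on, up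
to `e [n + m]`. -/
theorem IsListRealization.haltsFrom {e : List ℕ → D} (he : IsListRealization R e) {c : Code}
    {d : D} {m n j : ℕ} (h : R (.graph c) (e [n + m]) d) (v : Fin (j + 1) → D)
    (hv : v (Fin.last j) = e [n]) : (haltsFrom c m j).Holds R v := by
  induction m generalizing n j with
  | zero =>
    simp only [AffineBetweenness.haltsFrom, holds_ex, holds_rel, Fin.snoc_castSucc, Fin.snoc_last,
      hv]
    exact ⟨d, h⟩
  | succ m ih =>
    simp only [AffineBetweenness.haltsFrom, holds_ex, holds_and, holds_rel, Fin.snoc_castSucc,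
      Fin.snoc_last, hv]
    refine ⟨e [n + 1], he.succ n [], ih (n := n + 1) ?_ _ (Fin.snoc_last _ _)⟩
    rwa [add_right_comm, add_assoc]

theorem holds_haltingSentence {c : Code} {m : ℕ} (h : (c.eval [m]).Dom) :
    (haltingSentence c m).Holds R w := by
  rw [haltingSentence, holds_foldr_imp (fun φ => φ), List.forall_mem_append]
  rintro ⟨h₁, h₂⟩
  obtain ⟨e, he⟩ := exists_isListRealization h₁
  simp only [haltsOn, holds_ex, holds_and, holds_rel]
  refine ⟨e [], he.nil, e [0], he.zero [], he.haltsFrom (n := 0) (d := e ((c.eval [m]).get h)) ?_ _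
    (Fin.snoc_last _ _)⟩
  rw [zero_add]
  exact he.graph h₂ (Part.get_mem h)

end Soundness

/-! ### The intended model on lists -/

section Completeness

/-- The intended model of the axioms. -/
def listRel : Sym → List ℕ → List ℕ → Prop
  | .nil, u, _ => u = []
  | .zero, u, v => v = 0 :: u
  | .succ, u, v => v = (u.headI + 1) :: u.tail
  | .tail, u, v => v = u.tail
  | .head, u, v => u ≠ [] ∧ u.headI = v.headI
  | .graph c, u, v => v ∈ c.eval u
  | .dom, _, _ => False
  | .left, _, _ => False
  | .right, _, _ => False

/-- The symbols for lists. -/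
def listSymbols : List Sym := [.nil, .zero, .succ, .tail, .head]

/-- The symbols for the subcodes of a code. -/
def codeSymbols : Code → List Sym
  | .zero' => [.graph .zero']
  | .succ => [.graph .succ]
  | .tail => [.graph .tail]
  | .cons f fs => .graph (.cons f fs) :: (codeSymbols f ++ codeSymbols fs)
  | .comp f g => .graph (.comp f g) :: (codeSymbols f ++ codeSymbols g)
  | .case f g => .graph (.case f g) :: (codeSymbols f ++ codeSymbols g)
  | .fix f => .graph (.fix f) :: codeSymbols f

theorem graph_mem_codeSymbols (c : Code) : Sym.graph c ∈ codeSymbols c := by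
  cases c <;> simp [codeSymbols]

variable {R : Sym → List ℕ → List ℕ → Prop} {w : Fin 0 → List ℕ}

/-- Agreement with `listRel` is required only for symbols that occur, since the coded structure
interprets only finitely many symbols as intended. -/
theorem holds_listAxioms (hR : ∀ s ∈ listSymbols, R s = listRel s) :
    ∀ φ ∈ listAxioms, φ.Holds R w := by
  simp only [listSymbols, List.forall_mem_cons, List.not_mem_nil, false_implies, implies_true,
    and_true] at hR
  obtain ⟨h₁, h₂, h₃, h₄, h₅⟩ := hR
  simp only [listAxioms, List.forall_mem_cons, clause, holds_closure, List.foldr_cons,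
    List.foldr_nil, holds_imp, holds_rel, holds_ex, holds_all, List.not_mem_nil, false_implies,
    implies_true, and_true, h₁, h₂, h₃, h₄, h₅, listRel]
  refine ⟨⟨[], rfl⟩, fun d => ⟨0 :: d, rfl⟩, fun d => ⟨(d.headI + 1) :: d.tail, rfl⟩,
    ?_, ?_, ?_, ?_, ?_, ?_⟩
  · intro v h
    simp [h]
  · intro v h
    simp [h]
  · intro v h
    simp [h]
  · intro v h h'
    simp [h, h']
  · intro v h h'
    simp [h, h']
  · intro v h h' h''
    simp [h', h'', h.2]

theorem holds_codeAxioms {c : Code} (hR : ∀ s ∈ listSymbols, R s = listRel s)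
    (hc : ∀ s ∈ codeSymbols c, R s = listRel s) : ∀ φ ∈ codeAxioms c, φ.Holds R w := by
  simp only [listSymbols, List.forall_mem_cons, List.not_mem_nil, false_implies, implies_true,
    and_true] at hR
  obtain ⟨h₁, h₂, h₃, h₄, h₅⟩ := hR
  induction c with
  | zero' =>
    simp only [codeSymbols, List.forall_mem_cons] at hc
    simp only [codeAxioms, List.forall_mem_cons, clause, holds_closure, List.foldr_cons,
      List.foldr_nil, holds_imp, holds_rel, List.not_mem_nil, false_implies, implies_true,
      and_true, h₂, hc.1, listRel]
    intro v h
    simp [h]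
  | succ =>
    simp only [codeSymbols, List.forall_mem_cons] at hc
    simp only [codeAxioms, List.forall_mem_cons, clause, holds_closure, List.foldr_cons,
      List.foldr_nil, holds_imp, holds_rel, List.not_mem_nil, false_implies, implies_true,
      and_true, h₁, h₃, h₄, h₅, hc.1, listRel]
    intro v h₁ h₂ h₃ h₄
    obtain ⟨h₂, h₅⟩ := h₂
    rw [h₁] at h₅
    rw [h₄] at h₃
    revert h₂ h₃ h₅
    rcases v 2 with - | ⟨a, _ | _⟩ <;> simp
  | tail =>
    simp only [codeSymbols, List.forall_mem_cons] at hc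
    simp only [codeAxioms, List.forall_mem_cons, clause, holds_closure, List.foldr_cons,
      List.foldr_nil, holds_imp, holds_rel, List.not_mem_nil, false_implies, implies_true,
      and_true, h₄, hc.1, listRel]
    intro v h
    simp [h]
  | cons f fs ih₁ ih₂ =>
    simp only [codeSymbols, List.forall_mem_cons, List.forall_mem_append] at hc
    simp only [codeAxioms, List.forall_mem_cons, List.forall_mem_append]
    refine ⟨?_, ih₁ hc.2.1, ih₂ hc.2.2⟩
    simp only [clause, holds_closure, List.foldr_cons, List.foldr_nil, holds_imp, holds_rel, h₄,
      h₅, hc.1, hc.2.1 _ (graph_mem_codeSymbols f), hc.2.2 _ (graph_mem_codeSymbols fs), listRel]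
    intro v hf hfs ht hh
    simp only [Code.cons_eval, Part.bind_eq_bind, Part.mem_bind_iff, Part.pure_eq_some,
      Part.mem_some_iff]
    refine ⟨_, hf, _, hfs, ?_⟩
    rw [ht, ← hh.2]
    revert hh
    rcases v 3 with - | ⟨a, u⟩ <;> simp
  | comp f g ih₁ ih₂ =>
    simp only [codeSymbols, List.forall_mem_cons, List.forall_mem_append] at hc
    simp only [codeAxioms, List.forall_mem_cons, List.forall_mem_append]
    refine ⟨?_, ih₁ hc.2.1, ih₂ hc.2.2⟩
    simp only [clause, holds_closure, List.foldr_cons, List.foldr_nil, holds_imp, holds_rel,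
      hc.1, hc.2.1 _ (graph_mem_codeSymbols f), hc.2.2 _ (graph_mem_codeSymbols g), listRel]
    intro v hg hf
    rw [Code.comp_eval]
    exact Part.mem_bind_iff.2 ⟨_, hg, hf⟩
  | case f g ih₁ ih₂ =>
    simp only [codeSymbols, List.forall_mem_cons, List.forall_mem_append] at hc
    simp only [codeAxioms, List.forall_mem_cons, List.forall_mem_append]
    refine ⟨?_, ?_, ?_, ih₁ hc.2.1, ih₂ hc.2.2⟩ <;>
    simp only [clause, holds_closure, List.foldr_cons, List.foldr_nil, holds_imp, holds_rel,
      h₁, h₂, h₃, h₅,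
      hc.1, hc.2.1 _ (graph_mem_codeSymbols f), hc.2.2 _ (graph_mem_codeSymbols g), listRel]
    · intro v h hf
      rw [h] at hf ⊢
      simpa using hf
    · intro v h hf
      rw [h]
      simpa using hf
    -- The atom `head 0 0` excludes the empty list. Its successor is `[1]`, on which the case
    -- distinction calls `g` with `[0]` and not with `[]`.
    · intro v h hh hg
      rw [h]
      revert hh hg
      rcases v 0 with - | ⟨a, u⟩ <;> simp
  | fix f ih =>
    simp only [codeSymbols, List.forall_mem_cons] at hc
    simp only [codeAxioms, List.forall_mem_cons]
    refine ⟨?_, ?_, ?_, ih hc.2⟩ <;>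
    simp only [clause, holds_closure, List.foldr_cons, List.foldr_nil, holds_imp, holds_rel,
      h₁, h₂, h₃, h₄,
      hc.1, hc.2 _ (graph_mem_codeSymbols f), listRel, Code.fix_eval]
    · intro v hf h
      rw [h] at hf ⊢
      exact PFun.mem_fix_iff.2 (Or.inl (Part.mem_map_iff _ |>.2 ⟨_, hf, by simp⟩))
    · intro v hf h
      rw [h] at hf
      exact PFun.mem_fix_iff.2 (Or.inl (Part.mem_map_iff _ |>.2 ⟨_, hf, by simp⟩))
    · intro v hf h ht hr
      rw [h] at hf
      refine PFun.mem_fix_iff.2 (Or.inr ⟨v 3, Part.mem_map_iff _ |>.2 ⟨_, hf, ?_⟩, hr⟩)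
      simp [ht, h]

/-- In the intended model successors are unique, so the chain of quantified variables must run
through `[n]`, `[n + 1]`, up to `[n + m]`. -/
theorem exists_mem_eval_of_holds_haltsFrom (hR : R .succ = listRel .succ) {c : Code}
    (hc : R (.graph c) = listRel (.graph c)) {m n j : ℕ} {v : Fin (j + 1) → List ℕ}
    (hv : v (Fin.last j) = [n]) (h : (haltsFrom c m j).Holds R v) : ∃ u, u ∈ c.eval [n + m] := by
  induction m generalizing n j with
  | zero =>
    simpa only [haltsFrom, holds_ex, holds_rel, Fin.snoc_castSucc, Fin.snoc_last, hv, hc, listRel,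
      add_zero] using h
  | succ m ih =>
    simp only [haltsFrom, holds_ex, holds_and, holds_rel, Fin.snoc_castSucc, Fin.snoc_last, hv, hR,
      listRel] at h
    obtain ⟨d, hd, h⟩ := h
    rw [← add_assoc, add_right_comm]
    refine ih ?_ h
    rw [Fin.snoc_last]
    exact hd

theorem dom_of_holds_haltingSentence {c : Code} {m : ℕ}
    (hR : ∀ s ∈ listSymbols ++ codeSymbols c, R s = listRel s)
    (h : (haltingSentence c m).Holds R w) : (c.eval [m]).Dom := by
  rw [List.forall_mem_append] at hR
  rw [haltingSentence, holds_foldr_imp (fun φ => φ), List.forall_mem_append] at h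
  have h' := h ⟨holds_listAxioms hR.1, holds_codeAxioms hR.1 hR.2⟩
  simp only [haltsOn, holds_ex, holds_and, holds_rel, hR.1 .nil (by simp [listSymbols]),
    hR.1 .zero (by simp [listSymbols]), listRel] at h'
  obtain ⟨a, ha, b, hb, h'⟩ := h'
  have := exists_mem_eval_of_holds_haltsFrom (n := 0) (hR.1 .succ (by simp [listSymbols]))
    (hR.2 _ (graph_mem_codeSymbols c)) ?_ h'
  · rw [zero_add] at this
    exact Part.dom_iff_mem.2 this
  · exact hb.trans (congrArg _ ha)

end Completeness

end Machine

/-! ### Reduction of recursively enumerable sets to the two theories -/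

section Reduction

open Turing.ToPartrec (Code)

open RelFormula

/-- A recursively enumerable set is the domain of a partial recursive function with constant value
`0`. -/
theorem exists_code_dom_iff {p : ℕ → Prop} (hp : REPred p) :
    ∃ c : Code, ∀ m, (c.eval [m]).Dom ↔ p m := by
  have h : Partrec fun m : ℕ => (Part.assert (p m) fun _ => Part.some ()).map fun _ => 0 :=
    hp.map (Computable.const 0).to₂
  obtain ⟨c, hc⟩ := Code.exists_code (Nat.Partrec'.part_iff₁.2 h)
  refine ⟨c, fun m => ?_⟩
  have := hc ⟨[m], rfl⟩
  simp only at this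
  rw [this]
  simp [Part.assert]
  rfl

/-! ### Computability of the reduction -/

section Computability

variable {ι : Type} [Encodable ι]

/-- The number of an implication. -/
def impCode (a b : ℕ) : ℕ := 5 * Nat.pair a b + 4

/-- The number of a universal quantification. -/
def allCode (a : ℕ) : ℕ := 5 * a + 5

/-- The number of `predAtom`. -/
def predCode (r i : ℕ) : ℕ := 5 * Nat.pair r i + 3

/-- The number of `betaAtom`. -/
def betaCode (i j l : ℕ) : ℕ := 5 * Nat.pair i (Nat.pair j l) + 2

theorem formulaCode_falsum {k : ℕ} :
    formulaCode (.falsum : (betaLang ι).BoundedFormula Empty k) = 0 := rfl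

theorem formulaCode_imp {k : ℕ} (φ ψ : (betaLang ι).BoundedFormula Empty k) :
    formulaCode (.imp φ ψ) = impCode (formulaCode φ) (formulaCode ψ) := rfl

theorem formulaCode_all {k : ℕ} (φ : (betaLang ι).BoundedFormula Empty (k + 1)) :
    formulaCode (.all φ) = allCode (formulaCode φ) := rfl

theorem formulaCode_predAtom {k : ℕ} (r : ι) (i : Fin k) :
    formulaCode (predAtom r i) = predCode (Encodable.encode r) i := rfl

theorem formulaCode_betaAtom {k : ℕ} (i j l : Fin k) :
    formulaCode (betaAtom i j l : (betaLang ι).BoundedFormula Empty k) = betaCode i j l := rfl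

variable {α : Type*} [Primcodable α]

theorem primrec_five_mul_add {f : α → ℕ} (hf : Primrec f) (c : ℕ) :
    Primrec fun x => 5 * f x + c :=
  Primrec.nat_add.comp (Primrec.nat_mul.comp (Primrec.const 5) hf) (Primrec.const c)

theorem primrec_impCode {f g : α → ℕ} (hf : Primrec f) (hg : Primrec g) :
    Primrec fun x => impCode (f x) (g x) :=
  primrec_five_mul_add (Primrec₂.natPair.comp hf hg) 4

theorem primrec_allCode {f : α → ℕ} (hf : Primrec f) : Primrec fun x => allCode (f x) :=
  primrec_five_mul_add hf 5

theorem primrec_predCode {f g : α → ℕ} (hf : Primrec f) (hg : Primrec g) :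
    Primrec fun x => predCode (f x) (g x) :=
  primrec_five_mul_add (Primrec₂.natPair.comp hf hg) 3

theorem primrec_betaCode {f g h : α → ℕ} (hf : Primrec f) (hg : Primrec g) (hh : Primrec h) :
    Primrec fun x => betaCode (f x) (g x) (h x) :=
  primrec_five_mul_add (Primrec₂.natPair.comp hf (Primrec₂.natPair.comp hg hh)) 2

/-- Every variable index in this atom is `j` plus a constant, so the number is a fixed arithmetical
expression in `j`. -/
theorem primrec_formulaCode_gridAtom (a b r : ι) :
    Primrec fun j : ℕ => formulaCode
      (gridAtom a b r (Fin.last j).castSucc (Fin.last (j + 1)) :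
        (betaLang ι).BoundedFormula Empty (j + 2)) := by
  have hadd : ∀ c, Primrec fun j : ℕ => j + c := fun c =>
    Primrec.nat_add.comp Primrec.id (Primrec.const c)
  simp only [gridAtom, rayFormula, formulaCode_imp, formulaCode_all, formulaCode_falsum,
    formulaCode_predAtom, formulaCode_betaAtom, Fin.val_castSucc, Fin.val_last]
  repeat' first
    | apply primrec_impCode
    | apply primrec_allCode
    | apply primrec_predCode
    | apply primrec_betaCode
    | exact Primrec.const _
    | exact Primrec.id
    | exact hadd _
    | exact (hadd _).comp (hadd 2)

variable (h : Sym → ι) (a b d : ι)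

/-- The number of the translation of a step of `haltsFrom`, from that of the remaining formula. -/
def haltsFromStepCode (j x : ℕ) : ℕ :=
  impCode (allCode (impCode (predCode (Encodable.encode d) (j + 1))
    (impCode (impCode (impCode (formulaCode
      (gridAtom a b (h .succ) (Fin.last j).castSucc (Fin.last (j + 1)))) (impCode x 0)) 0) 0))) 0

theorem primrec_haltsFromStepCode {f g : α → ℕ} (hf : Primrec f) (hg : Primrec g) :
    Primrec fun x => haltsFromStepCode h a b d (f x) (g x) := by
  have hadd : ∀ c, Primrec fun x => f x + c := fun c =>
    Primrec.nat_add.comp hf (Primrec.const c)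
  unfold haltsFromStepCode
  repeat' first
    | exact (primrec_formulaCode_gridAtom a b _).comp hf
    | apply primrec_impCode
    | apply primrec_allCode
    | apply primrec_predCode
    | exact hg
    | exact hadd _
    | exact Primrec.const _

theorem formulaCode_haltsFrom_succ (c : Code) (m j : ℕ) :
    formulaCode ((haltsFrom c (m + 1) j).toBeta h a b d) =
      haltsFromStepCode h a b d j (formulaCode ((haltsFrom c m (j + 1)).toBeta h a b d)) := rfl

/-- The recursion of `haltsFrom` raises `j` as `m` drops, so `m + j` is invariant. Fixing it as `l +
1` turns the recursion into one on `m` alone: the step built on `i` remaining successors has level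
`l - i`. -/
theorem formulaCode_haltsFrom (c : Code) (l m j : ℕ) (hl : m + j = l + 1) :
    formulaCode ((haltsFrom c m j).toBeta h a b d) =
      Nat.rec (formulaCode ((haltsFrom c 0 (l + 1)).toBeta h a b d))
        (fun i x => haltsFromStepCode h a b d (l - i) x) m := by
  induction m generalizing j with
  | zero =>
    obtain rfl : j = l + 1 := by omega
    rfl
  | succ m ih =>
    rw [formulaCode_haltsFrom_succ, ih (j + 1) (by omega)]
    simp only
    congr 1
    omega

theorem primrec_formulaCode_haltsFrom (c : Code) :
    Primrec fun m => formulaCode ((haltsFrom c m 1).toBeta h a b d) := by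
  have h₀ : Primrec fun j => formulaCode ((haltsFrom c 0 j).toBeta h a b d) := by
    have hadd : ∀ c, Primrec fun j : ℕ => j + c := fun c =>
      Primrec.nat_add.comp Primrec.id (Primrec.const c)
    simp only [haltsFrom, ex, toBeta, formulaCode_imp, formulaCode_all, formulaCode_falsum,
      formulaCode_predAtom, Fin.val_last]
    repeat' first
      | exact primrec_formulaCode_gridAtom a b _
      | apply primrec_impCode
      | apply primrec_allCode
      | apply primrec_predCode
      | exact hadd _
      | exact Primrec.const _
  -- The instance `l = m`, `j = 1` of the preceding recursion.
  refine (Primrec.nat_rec' Primrec.id (h₀.comp Primrec.succ)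
    (h := fun m (y : ℕ × ℕ) => haltsFromStepCode h a b d (m - y.1) y.2) ?_).of_eq fun m => ?_
  · exact primrec_haltsFromStepCode h a b d
      (Primrec.nat_sub.comp Primrec.fst (Primrec.fst.comp Primrec.snd))
      (Primrec.snd.comp Primrec.snd)
  · exact (formulaCode_haltsFrom h a b d c m m 1 rfl).symm

/-- The axioms do not depend on `m`; they contribute constants wrapped around the number of the
conclusion. -/
theorem primrec_sentenceCode_haltingSentence (c : Code) :
    Primrec fun m => sentenceCode ((haltingSentence c m).toBeta h a b d) := by
  simp only [sentenceCode, haltingSentence]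
  generalize listAxioms ++ codeAxioms c = l
  induction l with
  | nil =>
    simp only [List.foldr_nil, haltsOn, ex, RelFormula.and, toBeta, formulaCode_imp,
      formulaCode_all, formulaCode_falsum]
    repeat' first
      | apply primrec_impCode
      | apply primrec_allCode
      | exact primrec_formulaCode_haltsFrom h a b d c
      | exact Primrec.const _
  | cons φ l ih =>
    simp only [List.foldr_cons, toBeta, formulaCode_imp]
    exact primrec_impCode (Primrec.const _) ih

end Computability

/-! ### Correctness of the reduction -/

variable {n : ℕ} {T : Set (EuclideanSpace ℝ (Fin n))} {ι : Type}

theorem holdsIn_iff_realizeIn (X : ι → Set T) (φ : (betaLang ι).Sentence) :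
    HoldsIn T X φ ↔ RealizeIn X φ Fin.elim0 := by
  unfold HoldsIn RealizeIn FirstOrder.Language.Sentence.Realize FirstOrder.Language.Formula.Realize
  rw [Subsingleton.elim (default : Empty → T) Empty.elim,
    Subsingleton.elim (default : Fin 0 → T) Fin.elim0]

/-- The set of points that codes the meaning of a symbol. -/
def symSet (p q : T) (g : List ℕ → List ℕ → T) : Sym → Set T
  | .dom => Set.range fun u => g u u
  | .left => {p}
  | .right => {q}
  | s => {x | ∃ u v, listRel s u v ∧ g u v = x}

/-- The symbols of the theory of a code. -/
def allSymbols (c : Code) : List Sym :=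
  .dom :: .left :: .right :: (listSymbols ++ codeSymbols c)

theorem exists_eq_graph_of_mem_codeSymbols {c : Code} {s : Sym} (hs : s ∈ codeSymbols c) :
    ∃ d, s = .graph d := by
  induction c with
  | zero' | succ | tail => exact ⟨_, List.mem_singleton.1 hs⟩
  | cons f g ih₁ ih₂ | comp f g ih₁ ih₂ | case f g ih₁ ih₂ =>
    rcases List.mem_cons.1 hs with h | h
    · exact ⟨_, h⟩
    · exact (List.mem_append.1 h).elim ih₁ ih₂
  | fix f ih => exact (List.mem_cons.1 hs).elim (fun h => ⟨_, h⟩) ih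

theorem symSet_eq_of_mem (p q : T) (g : List ℕ → List ℕ → T) {c : Code} {s : Sym}
    (hs : s ∈ listSymbols ++ codeSymbols c) :
    symSet p q g s = {x | ∃ u v, listRel s u v ∧ g u v = x} := by
  rcases List.mem_append.1 hs with h | h
  · simp only [listSymbols, List.mem_cons, List.not_mem_nil, or_false] at h
    rcases h with rfl | rfl | rfl | rfl | rfl <;> rfl
  · obtain ⟨d, rfl⟩ := exists_eq_graph_of_mem_codeSymbols h
    rfl

/-- Elements outside `l` receive the index `0`; only those in `l` matter. -/
theorem exists_index {α : Type*} {l : List α} (hl : 0 < l.length) :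
    ∃ h : α → Fin l.length, ∀ s ∈ l, l.get (h s) = s := by
  have : ∀ s, ∃ i : Fin l.length, s ∈ l → l.get i = s := fun s => by
    by_cases hs : s ∈ l
    · obtain ⟨i, hi⟩ := List.mem_iff_get.1 hs
      exact ⟨i, fun _ => hi⟩
    · exact ⟨⟨0, hl⟩, fun h => absurd h hs⟩
  choose h hh using this
  exact ⟨h, hh⟩

/-- The ray from `p` recovers the row and the ray from `q` the column of a marked grid point, while
the diagonal point `g u u` stands for the list `u`. -/
theorem gridRel_symSet_iff {p q : T} {g : List ℕ → List ℕ → T}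
    (hp : ∀ u v u' v', OnRay (p : EuclideanSpace ℝ (Fin n)) (g u v) (g u' v') ↔ u = u')
    (hq : ∀ u v u' v', OnRay (q : EuclideanSpace ℝ (Fin n)) (g u v) (g u' v') ↔ v = v')
    {X : ι → Set T} {a b r : ι} {s : Sym} (ha : X a = {p}) (hb : X b = {q})
    (hr : X r = {x | ∃ u v, listRel s u v ∧ g u v = x}) (u v : List ℕ) :
    GridRel X a b r (g u u) (g v v) ↔ listRel s u v := by
  simp only [GridRel, ha, hb, hr, Set.mem_singleton_iff, exists_eq_left, Set.mem_ofPred_eq]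
  constructor
  · rintro ⟨_, ⟨u', v', h, rfl⟩, h₁, h₂⟩
    rwa [(hp _ _ _ _).1 h₁, (hq _ _ _ _).1 h₂]
  · intro h
    exact ⟨_, ⟨u, v, h, rfl⟩, (hp _ _ _ _).2 rfl, (hq _ _ _ _).2 rfl⟩

/-- Whatever `X` is, `GridRel` defines a structure on the points of `X d`, and soundness holds in
every structure. -/
theorem realizeIn_haltingSentence {c : Code} {m : ℕ} (hm : (c.eval [m]).Dom) (X : ι → Set T)
    (h : Sym → ι) (a b d : ι) :
    RealizeIn X ((haltingSentence c m).toBeta h a b d) Fin.elim0 := by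
  let e : X d → T := Subtype.val
  rw [Subsingleton.elim Fin.elim0 (e ∘ Fin.elim0),
    realizeIn_toBeta (R := fun r u v => GridRel X a b (h r) (e u) (e v)) Subtype.range_val
      fun _ _ _ => Iff.rfl]
  exact holds_haltingSentence hm

/-- The map `k` inverts the numbering `h` on the relevant symbols, so predicate `i` can be given the
meaning of `k i`. Leaving `ι` general covers both finitely many set variables and the predicates
indexed by `ℕ`. -/
theorem forall_holdsIn_haltingSentence_iff (hT : ExtendsLinearly 2 T) (c : Code) {h : Sym → ι}
    {k : ι → Sym} (hk : ∀ s ∈ allSymbols c, k (h s) = s) (m : ℕ) :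
    (∀ X : ι → Set T, HoldsIn T X
      ((haltingSentence c m).toBeta h (h .left) (h .right) (h .dom))) ↔ (c.eval [m]).Dom := by
  simp only [holdsIn_iff_realizeIn]
  constructor
  · intro H
    obtain ⟨p, q, g, hp, hq⟩ := hT.exists_grid
    let g' : List ℕ → List ℕ → T := fun u v => g (Encodable.encode u) (Encodable.encode v)
    have hp' : ∀ u v u' v', OnRay (p : EuclideanSpace ℝ (Fin n)) (g' u v) (g' u' v') ↔ u = u' :=
      fun u v u' v' => (hp _ _ _ _).trans Encodable.encode_injective.eq_iff
    have hq' : ∀ u v u' v', OnRay (q : EuclideanSpace ℝ (Fin n)) (g' u v) (g' u' v') ↔ v = v' :=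
      fun u v u' v' => (hq _ _ _ _).trans Encodable.encode_injective.eq_iff
    let X : ι → Set T := fun i => symSet p q g' (k i)
    have hX : ∀ s ∈ allSymbols c, X (h s) = symSet p q g' s := fun s hs =>
      congrArg (symSet p q g') (hk s hs)
    have hdom := hX .dom (by simp [allSymbols])
    have hleft := hX .left (by simp [allSymbols])
    have hright := hX .right (by simp [allSymbols])
    have H' := H X
    rw [Subsingleton.elim Fin.elim0 ((fun u => g' u u) ∘ Fin.elim0),
      realizeIn_toBeta (e := fun u => g' u u)
        (R := fun r u v => GridRel X (h .left) (h .right) (h r) (g' u u) (g' v v))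
        hdom.symm (fun _ _ _ => Iff.rfl)] at H'
    refine dom_of_holds_haltingSentence (fun s hs => ?_) H'
    funext u v
    refine propext (gridRel_symSet_iff hp' hq' hleft hright ?_ u v)
    rw [hX s (by simp only [allSymbols, List.mem_cons, hs, or_true])]
    exact symSet_eq_of_mem p q g' hs
  · intro hm X
    exact realizeIn_haltingSentence hm X h _ _ _

theorem sigmaZeroOneHard_monadicPi11Theory (hT : ExtendsLinearly 2 T) :
    SigmaZeroOneHard MonadicPi11Sentence.code (monadicPi11Theory T) := by
  intro p hp
  obtain ⟨c, hc⟩ := exists_code_dom_iff hp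
  obtain ⟨h, hh⟩ := exists_index (l := allSymbols c) (by simp [allSymbols])
  refine ⟨fun m => ⟨_, (haltingSentence c m).toBeta h (h .left) (h .right) (h .dom)⟩, ?_,
    fun m => ?_⟩
  · exact (Primrec₂.natPair.comp (Primrec.const _)
      (primrec_sentenceCode_haltingSentence h _ _ _ c)).to_comp
  · exact (hc m).symm.trans (forall_holdsIn_haltingSentence_iff hT c hh m).symm

/-- The halting problem for codes, transferred to natural numbers by the numbering of codes. -/
theorem exists_rePred_not_computablePred : ∃ p : ℕ → Prop, REPred p ∧ ¬ ComputablePred p := by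
  refine ⟨fun m => (Nat.Partrec.Code.eval (Denumerable.ofNat Nat.Partrec.Code m) 0).Dom, ?_,
    fun h => ComputablePred.halting_problem 0 ?_⟩
  · exact (Nat.Partrec.Code.eval_part.comp (Computable.ofNat _) (Computable.const 0)).dom_re
  · obtain ⟨f, hf, hf'⟩ := ComputablePred.computable_iff.1 h
    refine ComputablePred.computable_iff.2 ⟨_, hf.comp Computable.encode, ?_⟩
    funext c
    have := congrFun hf' (Encodable.encode c)
    simpa only [Denumerable.ofNat_encode] using this

theorem isUndecidable_expansionTheory (hT : ExtendsLinearly 2 T) :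
    IsUndecidable (sentenceCode (ι := ℕ)) (expansionTheory T) := by
  rintro ⟨g, hg, hg'⟩
  obtain ⟨p, hp, hp'⟩ := exists_rePred_not_computablePred
  obtain ⟨c, hc⟩ := exists_code_dom_iff hp
  obtain ⟨h, hh⟩ := exists_index (l := allSymbols c) (by simp [allSymbols])
  -- Predicates are numbered by positions in `allSymbols c`; indices beyond the list get the
  -- irrelevant default `.dom`.
  have key := fun m => (hg' _).trans (forall_holdsIn_haltingSentence_iff (T := T) hT c
    (h := fun s => (h s : ℕ)) (k := fun i => (allSymbols c).getD i .dom)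
    (fun s hs => by simpa using hh s hs) m)
  refine hp' (ComputablePred.computable_iff.2 ⟨_, hg.comp
    (primrec_sentenceCode_haltingSentence (fun s => (h s : ℕ)) (h .left : ℕ) (h .right : ℕ)
      (h .dom : ℕ) c).to_comp, ?_⟩)
  funext m
  exact propext ((key m).trans (hc m)).symm

end Reduction

end AffineBetweenness

theorem mainTheorem3 {n : ℕ} (T : Set (EuclideanSpace ℝ (Fin n)))
    (hT : AffineBetweenness.ExtendsLinearly 2 T) :
    AffineBetweenness.SigmaZeroOneHard AffineBetweenness.MonadicPi11Sentence.code
        (AffineBetweenness.monadicPi11Theory T) ∧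
      AffineBetweenness.IsUndecidable (AffineBetweenness.sentenceCode (ι := ℕ))
        (AffineBetweenness.expansionTheory T) :=
  ⟨AffineBetweenness.sigmaZeroOneHard_monadicPi11Theory hT,
    AffineBetweenness.isUndecidable_expansionTheory hT⟩
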